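/- **Theorem 2.14 (Symbolic approximation, powerful polynomials).** Let $r, s \ge 2$ and $n \ge 0$ be integers and let $\mathbf q$ be an indeterminate. For $m \ge 0$ put $$P_{r,m}(\mathbf q) = \mathbf q^{\binom{r+m}{r}-1}\,\frac{1-\mathbf q^{-\binom{r+m-1}{r-1}}}{1-\mathbf q^{-1}} \in \mathbb Q(\mathbf q), \qquad P_r(z) = \sum_{m\ge 0} P_{r,m}(\mathbf q)\, z^m \in \mathbb Q(\mathbf q)[[z]],$$ the symbolic count of monic $r$-variate polynomials of degree $m$ over a field with $\mathbf q$ elements and its generating function. Define $S_{r,s}, Q_{r,s} \in \mathbb Q(\mathbf q)[[z]]$ by $$P_r(z) = S_{r,s}(z)\cdot P_r(z^s), \qquad Q_{r,s} = P_r - S_{r,s},$$ and let $Q_{r,n,s}(\mathbf q)$ be the coefficient of $z^n$ in $Q_{r,s}$; it is the symbolic formula for the number of $s$-powerful monic $r$-variate polynomials of degree $n$ (those divisible by the $s$-th power of a nonconstant polynomial). Put $$\eta_{r,n,s}(\mathbf q) = \mathbf q^{\binom{r+n-s}{r}+r-1}\,\frac{(1-\mathbf q^{-r})\bigl(1-\mathbf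 q^{-\binom{r+n-s-1}{r-1}}\bigr)}{(1-\mathbf q^{-1})^2} \quad (n \ge s),$$ $$\delta = \binom{r+n-s}{r}-\binom{r+n-2s}{r}-\frac{r(r+1)}2 \quad (n\ge 2s).$$ For a positive integer $m$, $O(\mathbf q^{-m})$ stands for some element of $\mathbb Q(\mathbf q)$ that is zero or has degree (numerator degree minus denominator degree) at most $-m$. Then: (i) If $n \ge 2s$, then $\delta \ge r$. (ii) $Q_{r,n,s}(\mathbf q) = 0$ for $n < s$; $Q_{r,n,s}(\mathbf q) = \eta_{r,n,s}(\mathbf q)$ for $s \le n < 2s$; and for $2s \le n < 3s$ $$Q_{r,n,s}(\mathbf q) = \eta_{r,n,s}(\mathbf q)\left(1+\mathbf q^{-\delta}\cdot\frac{1-\mathbf q^{-\binom{n+r-2s-1}{r-1}}}{1-\mathbf q^{-\binom{n+r-s-1}{r-1}}}\cdot\left(\frac{1-\mathbf q^{-r(r+1)/2}}{1-\mathbf q^{-r}}-\mathbf q^{-r(r-1)/2}\,\frac{1-\mathbf q^{-r}}{1-\mathbf q^{-1}}\right)\right).$$ (iii) For $(n,s) = (6,2)$, $$Q_{r,6,2}(\mathbf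 q) = \eta_{r,6,2}(\mathbf q)\left(1+\mathbf q^{-\delta+(r-2)(r-1)(r+3)/6}\cdot \varepsilon\right),$$ where $\varepsilon = 1+O(\mathbf q^{-1})$ if $r=2$, and $\varepsilon = \mathbf q^{-1}+O(\mathbf q^{-2})$ if $r \ge 3$. (iv) If $n \ge 2s$ and $(n,s) \ne (6,2)$, then $$Q_{r,n,s}(\mathbf q) = \eta_{r,n,s}(\mathbf q)\left(1+\mathbf q^{-\delta}\bigl(1+O(\mathbf q^{-1})\bigr)\right).$$ -/

import Mathlib

namespace SymbolicPowerful

noncomputable section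

/-- The symbolic variable `𝐪` of the field `ℚ(𝐪)`. -/
abbrev q : RatFunc ℚ := RatFunc.X

/-- The symbolic number of monic polynomials of degree `n` in `r` variables:
`𝐪^(binom(r+n, r) - 1) * (1 - 𝐪^(-binom(r+n-1, r-1))) / (1 - 𝐪⁻¹)`. -/
def P (r n : ℕ) : RatFunc ℚ :=
  q ^ ((Nat.choose (r + n) r : ℤ) - 1) *
    ((1 - q ^ (-(Nat.choose (r + n - 1) (r - 1) : ℤ))) / (1 - q ^ (-1 : ℤ)))

/-- The power series `P_r(𝐪, z) = ∑ₙ P_{r,n}(𝐪) zⁿ` in `ℚ(𝐪)⟦z⟧`. -/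
def PSeries (r : ℕ) : PowerSeries (RatFunc ℚ) :=
  PowerSeries.mk (P r)

/-- The power series `P_r(𝐪, z^s)`. -/
def PSeriesPow (r s : ℕ) : PowerSeries (RatFunc ℚ) :=
  PowerSeries.subst (PowerSeries.X ^ s : PowerSeries (RatFunc ℚ)) (PSeries r)

/-- The power series `S_{r,s}`, the solution of `P_r = S_{r,s} * P_r(z^s)`
(see `SSeries_mul`, `SSeries_unique`). -/
def SSeries (r s : ℕ) : PowerSeries (RatFunc ℚ) :=
  PSeries r * (PSeriesPow r s)⁻¹

/-- The power series `Q_{r,s} = P_r - S_{r,s}`. -/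
def QSeries (r s : ℕ) : PowerSeries (RatFunc ℚ) :=
  PSeries r - SSeries r s

/-- The symbolic number `Q_{r,n,s}(𝐪)` of `s`-powerful monic polynomials of degree `n` in
`r` variables: the coefficient of `zⁿ` in `Q_{r,s}`. -/
def Q (r n s : ℕ) : RatFunc ℚ :=
  PowerSeries.coeff n (QSeries r s)

/-- The main term `η_{r,n,s}(𝐪)`; meaningful for `n ≥ s`. -/
def eta (r n s : ℕ) : RatFunc ℚ :=
  q ^ ((Nat.choose (r + n - s) r : ℤ) + r - 1) *
    (((1 - q ^ (-(r : ℤ))) * (1 - q ^ (-(Nat.choose (r + n - s - 1) (r - 1) : ℤ)))) /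
      (1 - q ^ (-1 : ℤ)) ^ 2)

/-- The exponent `δ = binom(r+n-s, r) - binom(r+n-2s, r) - r(r+1)/2`, an integer (the division
is exact); meaningful for `n ≥ 2s`. -/
def delta (r n s : ℕ) : ℤ :=
  (Nat.choose (r + n - s) r : ℤ) - Nat.choose (r + n - 2 * s) r - (r : ℤ) * (r + 1) / 2

/-- `f = O(𝐪^(-m))`: the rational function `f` is zero or has degree (numerator degree minus
denominator degree) at most `-m`. -/
def IsBigOInv (m : ℕ) (f : RatFunc ℚ) : Prop :=
  f ≠ 0 → f.intDegree ≤ -(m : ℤ)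

theorem one_sub_q_inv_ne_zero : (1 : RatFunc ℚ) - q ^ (-1 : ℤ) ≠ 0 := by
  intro h
  have h1 : (RatFunc.X : RatFunc ℚ)⁻¹ = 1 := by
    rw [zpow_neg_one] at h
    exact (sub_eq_zero.mp h).symm
  have h2 := RatFunc.intDegree_inv (RatFunc.X : RatFunc ℚ)
  rw [h1, RatFunc.intDegree_one, RatFunc.intDegree_X] at h2
  norm_num at h2

theorem P_zero {r : ℕ} : P r 0 = 1 := by
  have h := one_sub_q_inv_ne_zero
  simp only [P, add_zero, Nat.choose_self, Nat.cast_one, sub_self, zpow_zero, one_mul]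
  exact div_self h

theorem constantCoeff_PSeriesPow {r s : ℕ} (hs : s ≠ 0) :
    PowerSeries.constantCoeff (PSeriesPow r s) = 1 := by
  rw [PSeriesPow, ← PowerSeries.expand_apply s hs, ← PowerSeries.coeff_zero_eq_constantCoeff_apply]
  have h := PowerSeries.coeff_expand_mul s hs (PSeries r) 0
  rw [mul_zero] at h
  rw [h, PSeries, PowerSeries.coeff_mk, P_zero]

/-- `S_{r,s}` satisfies its defining equation. -/
theorem SSeries_mul {r s : ℕ} (hs : s ≠ 0) :
    PSeries r = SSeries r s * PSeriesPow r s := by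
  have h : PowerSeries.constantCoeff (PSeriesPow r s) ≠ 0 := by
    rw [constantCoeff_PSeriesPow hs]; exact one_ne_zero
  rw [SSeries, mul_assoc, PowerSeries.inv_mul_cancel _ h, mul_one]

/-- `S_{r,s}` is the only solution of its defining equation. -/
theorem SSeries_unique {r s : ℕ} (hs : s ≠ 0) (T : PowerSeries (RatFunc ℚ))
    (hT : PSeries r = T * PSeriesPow r s) : T = SSeries r s := by
  have h : PowerSeries.constantCoeff (PSeriesPow r s) ≠ 0 := by
    rw [constantCoeff_PSeriesPow hs]; exact one_ne_zero
  rw [SSeries, hT, mul_assoc, PowerSeries.mul_inv_cancel _ h, mul_one]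

end

end SymbolicPowerful

namespace SymbolicPowerful

noncomputable section

/-! ### Degrees of rational functions -/

/-! Write 1/P_r(z) = Σ c_k z^k. Substituting z^s is a ring homomorphism, so S = P_r(z) · Σ c_k
z^(sk). The k = 0 term cancels P_r, leaving Q_n = Σ_{k ≥ 1} (-c_k) P_{n-sk} (`Q_eq_sum`). The k = 1
term is exactly η.

With C(x) = binom(r+x, r), P_m has leading term 𝐪^(C(m)-1). Superadditivity of C gives -c_k the same
leading term for k ≥ 1 (`hasMonicDegree_neg_invCoeff`), so the k-th term of Q_n has degree C(k) +
C(n-sk) - 2. Convexity of C makes k = 2 dominate all k ≥ 3 (`choose_add_choose_lt`), except possibly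
for (n,s) = (6,2); the degree gap between k = 2 and η is δ.

For (6,2) the degree at k = 3 minus that at k = 2 is (r-2)(r-1)(r+3)/6 - 1: negative for r = 2,
positive for r ≥ 3. This is the source of the extra 𝐪⁻¹ in ε. -/

/-- `f` is zero or has degree at most `d`. -/
def DegLE (d : ℤ) (f : RatFunc ℚ) : Prop :=
  f ≠ 0 → f.intDegree ≤ d

/-- `f = 𝐪 ^ d (1 + O(𝐪⁻¹))`. -/
def HasMonicDegree (d : ℤ) (f : RatFunc ℚ) : Prop :=
  DegLE (d - 1) (f - q ^ d)

theorem q_ne_zero : q ≠ 0 := RatFunc.X_ne_zero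

theorem intDegree_q_zpow (d : ℤ) : (q ^ d).intDegree = d := by
  have hnat : ∀ n : ℕ, (q ^ n).intDegree = n := by
    intro n
    induction n with
    | zero => simp
    | succ n ih =>
      rw [pow_succ, RatFunc.intDegree_mul (pow_ne_zero _ q_ne_zero) q_ne_zero, ih,
        RatFunc.intDegree_X]
      push_cast; ring
  obtain ⟨n, rfl | rfl⟩ := d.eq_nat_or_neg
  · rw [zpow_natCast, hnat]
  · rw [zpow_neg, zpow_natCast, RatFunc.intDegree_inv, hnat]

theorem degLE_zpow (d : ℤ) : DegLE d (q ^ d) := fun _ => (intDegree_q_zpow d).le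

theorem degLE_zero (d : ℤ) : DegLE d 0 := fun h => (h rfl).elim

theorem DegLE.mono {d e : ℤ} {f : RatFunc ℚ} (hf : DegLE d f) (h : d ≤ e) : DegLE e f :=
  fun h0 => (hf h0).trans h

theorem DegLE.add {d : ℤ} {f g : RatFunc ℚ} (hf : DegLE d f) (hg : DegLE d g) :
    DegLE d (f + g) := by
  intro h
  by_cases hf0 : f = 0
  · subst hf0; rw [zero_add] at h ⊢; exact hg h
  by_cases hg0 : g = 0
  · subst hg0; rw [add_zero] at h ⊢; exact hf h
  exact (RatFunc.intDegree_add_le hg0 h).trans (max_le (hf hf0) (hg hg0))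

theorem DegLE.neg {d : ℤ} {f : RatFunc ℚ} (hf : DegLE d f) : DegLE d (-f) := by
  intro h
  rw [RatFunc.intDegree_neg]
  exact hf (neg_ne_zero.mp h)

theorem DegLE.sub {d : ℤ} {f g : RatFunc ℚ} (hf : DegLE d f) (hg : DegLE d g) :
    DegLE d (f - g) := by
  rw [sub_eq_add_neg]; exact hf.add hg.neg

theorem DegLE.sum {ι : Type*} {d : ℤ} {t : Finset ι} {f : ι → RatFunc ℚ}
    (hf : ∀ i ∈ t, DegLE d (f i)) : DegLE d (∑ i ∈ t, f i) :=
  Finset.sum_induction f (DegLE d) (fun _ _ => DegLE.add) (degLE_zero d) hf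

theorem DegLE.mul {d e : ℤ} {f g : RatFunc ℚ} (hf : DegLE d f) (hg : DegLE e g) :
    DegLE (d + e) (f * g) := by
  intro h
  have hf0 := left_ne_zero_of_mul h
  have hg0 := right_ne_zero_of_mul h
  rw [RatFunc.intDegree_mul hf0 hg0]
  exact add_le_add (hf hf0) (hg hg0)

namespace HasMonicDegree

variable {d e : ℤ} {f g : RatFunc ℚ}

theorem degLE (hf : HasMonicDegree d f) : DegLE d f := by
  have h := (DegLE.mono hf (by omega)).add (degLE_zpow d)
  rwa [sub_add_cancel] at h

theorem not_degLE (hf : HasMonicDegree d f) : ¬ DegLE (d - 1) f := by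
  intro h
  have h2 := h.sub hf
  rw [sub_sub_cancel] at h2
  have := h2 (zpow_ne_zero _ q_ne_zero)
  rw [intDegree_q_zpow] at this
  omega

theorem ne_zero (hf : HasMonicDegree d f) : f ≠ 0 := by
  rintro rfl
  exact hf.not_degLE (degLE_zero _)

theorem intDegree_eq (hf : HasMonicDegree d f) : f.intDegree = d := by
  have h1 := hf.degLE hf.ne_zero
  by_contra h
  exact hf.not_degLE fun _ => by omega

theorem add_degLE (hf : HasMonicDegree d f) (hg : DegLE (d - 1) g) :
    HasMonicDegree d (f + g) := by
  have h := DegLE.add hf hg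
  rwa [sub_add_eq_add_sub] at h

theorem zpow (d : ℤ) : HasMonicDegree d (q ^ d) := by
  unfold HasMonicDegree; rw [sub_self]; exact degLE_zero _

theorem mul (hf : HasMonicDegree d f) (hg : HasMonicDegree e g) :
    HasMonicDegree (d + e) (f * g) := by
  have h1 : DegLE (d + e - 1) ((f - q ^ d) * g) := (DegLE.mul hf hg.degLE).mono (by omega)
  have h2 : DegLE (d + e - 1) (q ^ d * (g - q ^ e)) :=
    ((degLE_zpow d).mul hg).mono (by omega)
  have h := h1.add h2
  unfold HasMonicDegree
  rw [zpow_add₀ q_ne_zero]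
  convert h using 1
  ring

theorem inv (hf : HasMonicDegree d f) : HasMonicDegree (-d) f⁻¹ := by
  have h1 : DegLE (-d) f⁻¹ := fun _ => by rw [RatFunc.intDegree_inv, hf.intDegree_eq]
  have h2 := ((DegLE.neg hf).mul h1).mul (degLE_zpow (-d))
  refine DegLE.mono (e := -d - 1) ?_ le_rfl
  -- The three factors have degrees at most d - 1, -d and -d.
  have h3 : f⁻¹ - q ^ (-d) = -(f - q ^ d) * f⁻¹ * q ^ (-d) := by
    have := hf.ne_zero
    have := zpow_ne_zero d q_ne_zero
    rw [zpow_neg]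
    field_simp
    ring
  rw [h3]
  exact h2.mono (by omega)

theorem one_sub {m : ℤ} (hm : 1 ≤ m) : HasMonicDegree 0 (1 - q ^ (-m)) := by
  have h := (zpow 0).add_degLE (((degLE_zpow (-m)).neg).mono (by omega : -m ≤ 0 - 1))
  rwa [zpow_zero, ← sub_eq_add_neg] at h

end HasMonicDegree

/-! ### The coefficients of `P`, of its inverse, and of `Q` -/

theorem hasMonicDegree_P {r : ℕ} (hr : 1 ≤ r) (m : ℕ) :
    HasMonicDegree ((Nat.choose (r + m) r : ℤ) - 1) (P r m) := by
  have hc : (1 : ℤ) ≤ Nat.choose (r + m - 1) (r - 1) := by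
    exact_mod_cast Nat.choose_pos (by omega)
  have h := (HasMonicDegree.zpow ((Nat.choose (r + m) r : ℤ) - 1)).mul
    ((HasMonicDegree.one_sub hc).mul (HasMonicDegree.one_sub le_rfl).inv)
  simpa only [P, neg_zero, add_zero, ← div_eq_mul_inv] using h

/-- The coefficients of the inverse of `P_r(z)`. -/
def invCoeff (r k : ℕ) : RatFunc ℚ := PowerSeries.coeff k (PSeries r)⁻¹

theorem PSeries_mul_inv (r : ℕ) : PSeries r * (PSeries r)⁻¹ = 1 := by
  apply PowerSeries.mul_inv_cancel
  rw [← PowerSeries.coeff_zero_eq_constantCoeff_apply, PSeries, PowerSeries.coeff_mk, P_zero]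
  exact one_ne_zero

theorem invCoeff_zero (r : ℕ) : invCoeff r 0 = 1 := by
  simp [PSeries, P_zero, invCoeff]

/-- Compares coefficients in P_r · P_r⁻¹ = 1. Only inverse coefficients of index 1 to k remain on
the right, as strong induction requires. -/
theorem invCoeff_succ (r k : ℕ) :
    -invCoeff r (k + 1) =
      P r (k + 1) + ∑ i ∈ Finset.range k, P r (i + 1) * invCoeff r (k - i) := by
  have h := congrArg (PowerSeries.coeff (k + 1)) (PSeries_mul_inv r)
  rw [PowerSeries.coeff_mul, Finset.Nat.sum_antidiagonal_eq_sum_range_succ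
    (fun i j => PowerSeries.coeff i (PSeries r) * PowerSeries.coeff j (PSeries r)⁻¹),
    Finset.sum_range_succ, Finset.sum_range_succ', PowerSeries.coeff_one,
    if_neg (Nat.succ_ne_zero k), Nat.sub_self, Nat.sub_zero] at h
  simp only [PSeries, PowerSeries.coeff_mk, P_zero, one_mul, Nat.add_sub_add_right] at h
  change _ + invCoeff r (k + 1) + P r (k + 1) * invCoeff r 0 = 0 at h
  rw [invCoeff_zero] at h
  simp only [invCoeff, PSeries] at h ⊢
  linear_combination -h

theorem SSeries_eq (r : ℕ) {s : ℕ} (hs : s ≠ 0) :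
    SSeries r s = PowerSeries.expand s hs (PSeries r)⁻¹ * PSeries r := by
  refine (SSeries_unique hs _ ?_).symm
  rw [PSeriesPow, ← PowerSeries.expand_apply s hs, mul_right_comm, ← map_mul, mul_comm (_)⁻¹,
    PSeries_mul_inv, map_one, one_mul]

theorem coeff_SSeries (r n : ℕ) {s : ℕ} (hs : s ≠ 0) :
    PowerSeries.coeff n (SSeries r s) =
      ∑ k ∈ Finset.range (n / s + 1), invCoeff r k * P r (n - s * k) := by
  rw [SSeries_eq r hs, PowerSeries.coeff_mul, Finset.Nat.sum_antidiagonal_eq_sum_range_succ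
    (fun i j => PowerSeries.coeff i (PowerSeries.expand s hs (PSeries r)⁻¹) *
      PowerSeries.coeff j (PSeries r))]
  symm
  -- The expanded series is supported on multiples of s, so only indices s * k contribute.
  refine Finset.sum_of_injOn (fun k => s * k) ?_ ?_ ?_ ?_
  · exact fun _ _ _ _ h => Nat.eq_of_mul_eq_mul_left (Nat.pos_of_ne_zero hs) h
  · intro k hk
    simp only [Finset.coe_range, Set.mem_Iio, Nat.lt_succ_iff] at hk ⊢
    exact (Nat.mul_le_mul_left s hk).trans (Nat.mul_div_le n s)
  · intro j hj hj'
    rw [PowerSeries.coeff_expand_of_not_dvd, zero_mul]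
    rintro ⟨k, rfl⟩
    refine hj' ⟨k, ?_, rfl⟩
    simp only [Finset.coe_range, Set.mem_Iio, Finset.mem_range, Nat.lt_succ_iff] at hj ⊢
    rw [Nat.le_div_iff_mul_le (Nat.pos_of_ne_zero hs), mul_comm]
    exact hj
  · intro k _
    rw [PowerSeries.coeff_expand_mul, invCoeff, PSeries, PowerSeries.coeff_mk]

theorem Q_eq_sum (r n : ℕ) {s : ℕ} (hs : s ≠ 0) :
    Q r n s = ∑ k ∈ Finset.range (n / s), -invCoeff r (k + 1) * P r (n - s * (k + 1)) := by
  rw [Q, QSeries, map_sub, coeff_SSeries r n hs, Finset.sum_range_succ', invCoeff_zero, mul_zero,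
    Nat.sub_zero, one_mul, PSeries, PowerSeries.coeff_mk]
  simp only [neg_mul, Finset.sum_neg_distrib]
  ring

/-! ### Convexity of binomial coefficients -/

theorem choose_add_succ {r : ℕ} (hr : 1 ≤ r) (x : ℕ) :
    Nat.choose (r + (x + 1)) r = Nat.choose (r + x) r + Nat.choose (r + x) (r - 1) := by
  obtain ⟨t, rfl⟩ := Nat.exists_eq_add_of_le' hr
  rw [← add_assoc, Nat.choose_succ_succ' (t + 1 + x) t, Nat.add_sub_cancel, add_comm]

theorem choose_add_lt {r : ℕ} (hr : 1 ≤ r) {x y : ℕ} (h : x < y) :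
    Nat.choose (r + x) r < Nat.choose (r + y) r := by
  refine strictMono_nat_of_lt_succ (f := fun x => Nat.choose (r + x) r) (fun x => ?_) h
  simp only [choose_add_succ hr]
  exact Nat.lt_add_of_pos_right (Nat.choose_pos (by omega))

theorem choose_add_le {r x y : ℕ} (h : x ≤ y) :
    Nat.choose (r + x) r ≤ Nat.choose (r + y) r :=
  Nat.choose_le_choose r (by omega)

/-- The increment binom(r+x, r-1) is monotone in x; summing j increments from x and from y gives the
inequality. -/
theorem choose_add_add_le {r : ℕ} (hr : 1 ≤ r) {x y : ℕ} (h : x ≤ y) (j : ℕ) :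
    Nat.choose (r + y) r + Nat.choose (r + (x + j)) r ≤
      Nat.choose (r + x) r + Nat.choose (r + (y + j)) r := by
  induction j with
  | zero => simp only [add_zero]; omega
  | succ j ih =>
    have h1 := choose_add_succ hr (x + j)
    have h2 := choose_add_succ hr (y + j)
    have h3 : Nat.choose (r + (x + j)) (r - 1) ≤ Nat.choose (r + (y + j)) (r - 1) :=
      Nat.choose_le_choose _ (by omega)
    rw [← add_assoc x, ← add_assoc y]
    omega

theorem choose_add_add_lt {r : ℕ} (hr : 2 ≤ r) {x y j : ℕ} (h : x < y) (hj : 0 < j) :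
    Nat.choose (r + y) r + Nat.choose (r + (x + j)) r <
      Nat.choose (r + x) r + Nat.choose (r + (y + j)) r := by
  obtain _ | i := j
  · omega
  have h0 := choose_add_add_le (by omega : 1 ≤ r) h.le i
  have h1 := choose_add_succ (by omega : 1 ≤ r) (x + i)
  have h2 := choose_add_succ (by omega : 1 ≤ r) (y + i)
  have h3 : Nat.choose (r + (x + i)) (r - 1) < Nat.choose (r + (y + i)) (r - 1) := by
    refine lt_of_lt_of_le ?_
      (Nat.choose_le_choose _ (by omega : r + (x + i) + 1 ≤ r + (y + i)))
    obtain ⟨t, rfl⟩ := Nat.exists_eq_add_of_le' hr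
    rw [show t + 2 - 1 = t + 1 by omega, Nat.choose_succ_succ' (t + 2 + (x + i)) t]
    have : 0 < Nat.choose (t + 2 + (x + i)) t := Nat.choose_pos (by omega)
    omega
  rw [← add_assoc x, ← add_assoc y]
  omega

/-- Strict convexity based at 0; strictness absorbs binom(r, r) = 1. -/
theorem choose_add_choose_le {r : ℕ} (hr : 2 ≤ r) {i j : ℕ} (hi : 0 < i) (hj : 0 < j) :
    Nat.choose (r + i) r + Nat.choose (r + j) r ≤ Nat.choose (r + (i + j)) r := by
  have h := choose_add_add_lt hr hi hj
  rw [zero_add, add_zero, Nat.choose_self] at h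
  omega

/-- Among the terms `k ≥ 2` of `Q_{r,n,s}`, the one for `k = 2` dominates. -/
theorem choose_add_choose_lt {r s k m : ℕ} (hr : 2 ≤ r) (hs : 2 ≤ s) (hk : 3 ≤ k)
    (h : ¬ (k = 3 ∧ s = 2 ∧ m = 0)) :
    Nat.choose (r + k) r + Nat.choose (r + m) r <
      Nat.choose (r + 2) r + Nat.choose (r + (m + s * (k - 2))) r := by
  have hr1 : 1 ≤ r := by omega
  have hsk : 2 * (k - 2) ≤ s * (k - 2) := Nat.mul_le_mul_right _ hs
  -- For m < 2 the two binomials compare separately; k ≤ m + s(k-2) fails only in the excluded case.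
  -- For m ≥ 2, convexity exchanges k with 2, and s ≥ 2 gives strictness.
  rcases lt_or_ge m 2 with hm | hm
  · have hk' : k ≤ m + s * (k - 2) := by
      rcases eq_or_ne k 3 with rfl | hk3
      · simp only [Nat.reduceSub, mul_one] at hsk ⊢
        omega
      · omega
    have h1 := choose_add_lt hr1 hm
    have h2 := choose_add_le (r := r) hk'
    omega
  · obtain ⟨j, rfl⟩ := Nat.exists_eq_add_of_le hm
    have h1 := choose_add_add_le hr1 (by omega : 2 ≤ k) j
    have h2 := choose_add_lt hr1 (by omega : k + j < 2 + j + s * (k - 2))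
    omega

/-- In the recursion P_{k+1} dominates: a product has degree C(i) + C(j) - 2 with i + j = k + 1, at
most C(k+1) - 2 by superadditivity. -/
theorem hasMonicDegree_neg_invCoeff {r : ℕ} (hr : 2 ≤ r) (k : ℕ) :
    HasMonicDegree ((Nat.choose (r + (k + 1)) r : ℤ) - 1) (-invCoeff r (k + 1)) := by
  induction k using Nat.strong_induction_on with
  | _ k ih =>
    rw [invCoeff_succ]
    refine (hasMonicDegree_P (by omega) _).add_degLE (DegLE.sum fun i hi => ?_)
    rw [Finset.mem_range] at hi
    obtain ⟨j, rfl⟩ := Nat.exists_eq_add_of_lt hi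
    have h1 := (hasMonicDegree_P (by omega : 1 ≤ r) (i + 1)).degLE
    have h2 := (ih j (by omega)).degLE.neg
    rw [neg_neg] at h2
    rw [show i + j + 1 - i = j + 1 by omega]
    refine (h1.mul h2).mono ?_
    have h3 := choose_add_choose_le hr (Nat.succ_pos i) (Nat.succ_pos j)
    rw [show i.succ + j.succ = i + j + 1 + 1 by omega] at h3
    simp only [Nat.succ_eq_add_one] at h3
    omega


/-! ### The theorem -/

/-! ### Exponents as binomial coefficients, and the bound on δ -/

theorem two_mul_choose_add_two (r : ℕ) :
    2 * (Nat.choose (r + 2) r : ℤ) = (r + 1) * (r + 2) := by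
  have h := Nat.descFactorial_eq_factorial_mul_choose (r + 2) 2
  rw [← Nat.choose_symm_add] at h
  have h2 : (r + 1) * (r + 2) = 2 * Nat.choose (r + 2) r := by
    simpa [Nat.descFactorial_succ, Nat.factorial] using h
  exact_mod_cast h2.symm

theorem six_mul_choose_add_three (r : ℕ) :
    6 * (Nat.choose (r + 3) r : ℤ) = (r + 1) * ((r + 2) * (r + 3)) := by
  have h := Nat.descFactorial_eq_factorial_mul_choose (r + 3) 3
  rw [← Nat.choose_symm_add] at h
  have h2 : (r + 1) * ((r + 2) * (r + 3)) = 6 * Nat.choose (r + 3) r := by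
    simpa [Nat.descFactorial_succ, Nat.factorial] using h
  exact_mod_cast h2.symm

theorem mul_succ_div_two (r : ℕ) :
    (r : ℤ) * (r + 1) / 2 = (Nat.choose (r + 2) r : ℤ) - 1 - r := by
  refine Int.ediv_eq_of_eq_mul_right two_ne_zero ?_
  linear_combination -two_mul_choose_add_two r

theorem mul_pred_div_two (r : ℕ) :
    (r : ℤ) * (r - 1) / 2 = (Nat.choose (r + 2) r : ℤ) - 1 - 2 * r := by
  have h : (r : ℤ) * (r - 1) = r * (r + 1) + -r * 2 := by ring
  rw [h, Int.add_mul_ediv_right _ _ two_ne_zero, mul_succ_div_two]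
  ring

theorem cubic_div_six (r : ℕ) :
    ((r : ℤ) - 2) * (r - 1) * (r + 3) / 6 =
      (Nat.choose (r + 3) r : ℤ) - 2 * Nat.choose (r + 2) r + 2 := by
  refine Int.ediv_eq_of_eq_mul_right (by norm_num) ?_
  linear_combination 6 * two_mul_choose_add_two r - six_mul_choose_add_three r

theorem delta_eq (r n s : ℕ) :
    delta r n s = (Nat.choose (r + n - s) r : ℤ) - Nat.choose (r + n - 2 * s) r -
      (Nat.choose (r + 2) r - 1 - r) := by
  rw [delta, mul_succ_div_two]

theorem le_delta {r s n : ℕ} (hr : 2 ≤ r) (hs : 2 ≤ s) (hn : 2 * s ≤ n) :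
    (r : ℤ) ≤ delta r n s := by
  obtain ⟨m, rfl⟩ := Nat.exists_eq_add_of_le hn
  -- Convexity bounds C(m+s) - C(m) below by C(s) - C(0), hence by C(2) - 1.
  have h1 := choose_add_add_le (by omega : 1 ≤ r) (Nat.zero_le m) s
  have h2 := choose_add_le (r := r) hs
  rw [zero_add, add_zero, Nat.choose_self] at h1
  rw [delta_eq, show r + (2 * s + m) - s = r + (m + s) by omega,
    show r + (2 * s + m) - 2 * s = r + m by omega]
  omega

theorem P_one {r : ℕ} (hr : 1 ≤ r) :
    P r 1 = q ^ (r : ℤ) * ((1 - q ^ (-(r : ℤ))) / (1 - q ^ (-1 : ℤ))) := by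
  obtain ⟨t, rfl⟩ := Nat.exists_eq_add_of_le' hr
  have h1 : Nat.choose (t + 1 + 1) (t + 1) = t + 1 + 1 := Nat.choose_succ_self_right _
  have h2 : Nat.choose (t + 1) t = t + 1 := Nat.choose_succ_self_right _
  simp only [P, Nat.add_sub_cancel, h1, h2]
  push_cast
  rw [add_sub_cancel_right]

theorem eta_eq {r s n : ℕ} (hr : 1 ≤ r) (hn : s ≤ n) : eta r n s = P r 1 * P r (n - s) := by
  rw [P_one hr, P, eta, show r + n - s = r + (n - s) by omega, add_sub_assoc, add_comm (_ : ℤ),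
    sub_add_comm, add_comm _ (r : ℤ), zpow_add₀ q_ne_zero, pow_two, ← div_mul_div_comm]
  ring

theorem Q_of_lt {r s n : ℕ} (hs : s ≠ 0) (hn : n < s) : Q r n s = 0 := by
  rw [Q_eq_sum r n hs, Nat.div_eq_of_lt hn, Finset.sum_range_zero]

/-- The terms of `Q_{r,n,s}` beyond the main term. -/
def QTail (r n s : ℕ) : RatFunc ℚ :=
  ∑ k ∈ Finset.range (n / s - 1), -invCoeff r (k + 2) * P r (n - s * (k + 2))

theorem neg_invCoeff_one (r : ℕ) : -invCoeff r 1 = P r 1 := by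
  rw [invCoeff_succ r 0, Finset.sum_range_zero, add_zero]

theorem neg_invCoeff_two (r : ℕ) : -invCoeff r 2 = P r 2 - P r 1 ^ 2 := by
  rw [invCoeff_succ r 1, Finset.sum_range_one]
  linear_combination -P r 1 * neg_invCoeff_one r

theorem Q_eq_eta_add {r s n : ℕ} (hr : 1 ≤ r) (hs : s ≠ 0) (hn : s ≤ n) :
    Q r n s = eta r n s + QTail r n s := by
  have h : n / s = n / s - 1 + 1 :=
    (Nat.sub_add_cancel (Nat.div_pos hn (Nat.pos_of_ne_zero hs))).symm
  rw [Q_eq_sum r n hs, h, Finset.sum_range_succ', zero_add, mul_one, neg_invCoeff_one,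
    eta_eq hr hn, add_comm, QTail]

/-! ### Leading terms of η and of the tail -/

theorem hasMonicDegree_eta {r s n : ℕ} (hr : 1 ≤ r) (hn : s ≤ n) :
    HasMonicDegree ((Nat.choose (r + n - s) r : ℤ) - 1 + r) (eta r n s) := by
  rw [eta_eq hr hn]
  have h1 := hasMonicDegree_P hr 1
  rw [Nat.choose_succ_self_right, Nat.cast_succ, add_sub_cancel_right] at h1
  rw [add_comm, show r + n - s = r + (n - s) by omega]
  exact h1.mul (hasMonicDegree_P hr _)

theorem hasMonicDegree_QTail_term {r : ℕ} (hr : 2 ≤ r) (n s k : ℕ) :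
    HasMonicDegree ((Nat.choose (r + (k + 2)) r : ℤ) - 1 +
      (Nat.choose (r + (n - s * (k + 2))) r - 1))
      (-invCoeff r (k + 2) * P r (n - s * (k + 2))) :=
  (hasMonicDegree_neg_invCoeff hr (k + 1)).mul (hasMonicDegree_P (by omega) _)

theorem hasMonicDegree_QTail {r s n : ℕ} (hr : 2 ≤ r) (hs : 2 ≤ s) (hn : 2 * s ≤ n)
    (h : (n, s) ≠ (6, 2)) :
    HasMonicDegree ((Nat.choose (r + 2) r : ℤ) - 1 + (Nat.choose (r + n - 2 * s) r - 1))
      (QTail r n s) := by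
  have h2 : 2 ≤ n / s := (Nat.le_div_iff_mul_le (by omega)).mpr hn
  obtain ⟨K, hK⟩ : ∃ K, n / s - 1 = K + 1 := ⟨n / s - 2, by omega⟩
  rw [QTail, hK, Finset.sum_range_succ', add_comm (Finset.sum _ _)]
  have h0 := hasMonicDegree_QTail_term hr n s 0
  rw [zero_add, mul_comm s 2, ← Nat.add_sub_assoc hn] at h0
  rw [zero_add, mul_comm s 2]
  refine h0.add_degLE (DegLE.sum fun k hk => ?_)
  refine (hasMonicDegree_QTail_term hr n s (k + 1)).degLE.mono ?_
  have hk' : s * (k + 3) ≤ n := by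
    rw [Finset.mem_range] at hk
    exact (Nat.mul_le_mul_left s (by omega)).trans (Nat.mul_div_le n s)
  obtain ⟨m, rfl⟩ := Nat.exists_eq_add_of_le hk'
  have h3 := choose_add_choose_lt (m := m) hr hs (by omega : 3 ≤ k + 3) (by
    rintro ⟨h3, rfl, rfl⟩
    exact h (by rw [h3]))
  rw [show k + 1 + 2 = k + 3 by ring, Nat.add_sub_cancel_left]
  have h4 : r + (s * (k + 3) + m) - 2 * s = r + (m + s * (k + 3 - 2)) := by
    rw [show k + 3 - 2 = k + 1 by omega]
    have : s * (k + 3) = s * (k + 1) + 2 * s := by ring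
    omega
  rw [h4]
  omega

/-- For `(n, s) = (6, 2)` and `r ≥ 3`, the third term dominates the second one. -/
theorem hasMonicDegree_QTail_six_two {r : ℕ} (hr : 3 ≤ r) :
    HasMonicDegree ((Nat.choose (r + 3) r : ℤ) - 1) (QTail r 6 2) := by
  have h1 : HasMonicDegree ((Nat.choose (r + 3) r : ℤ) - 1) (-invCoeff r 3 * P r 0) := by
    simpa using hasMonicDegree_QTail_term (by omega : 2 ≤ r) 6 2 1
  have h0 := hasMonicDegree_QTail_term (by omega : 2 ≤ r) 6 2 0
  simp only [zero_add, Nat.reduceMul, Nat.reduceSub] at h0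
  rw [QTail, show 6 / 2 - 1 = 2 by norm_num, Finset.sum_range_succ, Finset.sum_range_one,
    add_comm (_ * _)]
  refine h1.add_degLE (h0.degLE.mono ?_)
  have h2 : (0 : ℤ) ≤ (r - 3) * (r + 3) := mul_nonneg (by omega) (by omega)
  -- The cubic is at least 12, with equality at r = 3, so k = 3 wins by at least one degree.
  have h4 := (Int.le_ediv_iff_mul_le (by norm_num : (0 : ℤ) < 6)).mpr
    (by nlinarith : 2 * 6 ≤ ((r : ℤ) - 2) * (r - 1) * (r + 3))
  rw [cubic_div_six] at h4
  omega

theorem hasMonicDegree_QTail_two_six_two :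
    HasMonicDegree 10 (QTail 2 6 2) := by
  have h1 := hasMonicDegree_QTail_term le_rfl 6 2 1
  have h0 := hasMonicDegree_QTail_term le_rfl 6 2 0
  rw [QTail, show 6 / 2 - 1 = 2 by norm_num, Finset.sum_range_succ, Finset.sum_range_one]
  norm_num [Nat.choose] at h0 h1 ⊢
  -- Here k = 2 has degree 10 and k = 3 only 9.
  exact h0.add_degLE (h1.degLE.mono (by norm_num))

theorem HasMonicDegree.exists_eq {d : ℤ} {f : RatFunc ℚ} (hf : HasMonicDegree d f) :
    ∃ e, DegLE (-1) e ∧ f = q ^ d * (1 + e) := by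
  refine ⟨q ^ (-d) * (f - q ^ d), ((degLE_zpow _).mul hf).mono (by omega), ?_⟩
  have := zpow_ne_zero d q_ne_zero
  rw [zpow_neg]
  field_simp
  ring

/-- If `g` and `h` have leading terms `𝐪 ^ d'` and `𝐪 ^ d`, then `g + h` is
`g (1 + 𝐪 ^ (d - d') (1 + O(𝐪⁻¹)))`. -/
theorem exists_add_eq_mul {d d' : ℤ} {g h : RatFunc ℚ} (hg : HasMonicDegree d' g)
    (hh : HasMonicDegree d h) :
    ∃ e, DegLE (-1) e ∧ g + h = g * (1 + q ^ (d - d') * (1 + e)) := by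
  obtain ⟨e, he, heq⟩ := (hh.mul hg.inv).exists_eq
  refine ⟨e, he, ?_⟩
  rw [sub_eq_add_neg, ← heq]
  have := hg.ne_zero
  field_simp

/-! ### The closed form for 2s ≤ n < 3s -/

theorem P_eq_zpow_mul {r : ℕ} (hr : 1 ≤ r) (m k : ℕ) :
    P r m = P r k * (q ^ ((Nat.choose (r + m) r : ℤ) - Nat.choose (r + k) r) *
      ((1 - q ^ (-(Nat.choose (r + m - 1) (r - 1) : ℤ))) /
        (1 - q ^ (-(Nat.choose (r + k - 1) (r - 1) : ℤ))))) := by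
  have hc : (1 : ℤ) ≤ Nat.choose (r + k - 1) (r - 1) := by
    exact_mod_cast Nat.choose_pos (by omega)
  have h1 := (HasMonicDegree.one_sub hc).ne_zero
  have h2 := zpow_ne_zero (Nat.choose (r + k) r : ℤ) q_ne_zero
  have h3 := one_sub_q_inv_ne_zero
  simp only [P]
  rw [zpow_sub₀ q_ne_zero (Nat.choose (r + m) r : ℤ) 1,
    zpow_sub₀ q_ne_zero (Nat.choose (r + k) r : ℤ) 1, zpow_sub₀ q_ne_zero]
  generalize 1 - q ^ (-(Nat.choose (r + k - 1) (r - 1) : ℤ)) = a at *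
  generalize 1 - q ^ (-1 : ℤ) = b at *
  generalize q ^ (Nat.choose (r + k) r : ℤ) = c at *
  field_simp

theorem choose_succ_pred {r : ℕ} (hr : 1 ≤ r) :
    (Nat.choose (r + 2 - 1) (r - 1) : ℤ) = (r : ℤ) * (r + 1) / 2 := by
  rw [mul_succ_div_two]
  have h := choose_add_succ hr 1
  rw [Nat.choose_succ_self_right] at h
  rw [show r + 2 - 1 = r + 1 by omega]
  have h' : Nat.choose (r + 2) r = r + 1 + Nat.choose (r + 1) (r - 1) := h
  omega

theorem Q_of_lt_three_mul {r s n : ℕ} (hr : 2 ≤ r) (hs : 2 ≤ s) (hn : 2 * s ≤ n)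
    (hn' : n < 3 * s) :
    Q r n s = eta r n s *
      (1 + q ^ (-delta r n s) *
        ((1 - q ^ (-(Nat.choose (n + r - 2 * s - 1) (r - 1) : ℤ))) /
          (1 - q ^ (-(Nat.choose (n + r - s - 1) (r - 1) : ℤ)))) *
        ((1 - q ^ (-((r : ℤ) * (r + 1) / 2))) / (1 - q ^ (-(r : ℤ))) -
          q ^ (-((r : ℤ) * (r - 1) / 2)) * ((1 - q ^ (-(r : ℤ))) / (1 - q ^ (-1 : ℤ))))) := by
  have hr1 : 1 ≤ r := by omega
  have hdiv : n / s = 2 := Nat.div_eq_of_lt_le hn hn'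
  -- These ratios extract η = P_1 P_{n-s} from the only tail term, (P_2 - P_1²) P_{n-2s}.
  have h1 := P_eq_zpow_mul hr1 (n - 2 * s) (n - s)
  have h2 := P_eq_zpow_mul hr1 2 1
  rw [choose_succ_pred hr1, Nat.choose_succ_self_right, Nat.add_sub_cancel,
    Nat.choose_symm_of_eq_add (by omega : r = (r - 1) + 1), Nat.choose_one_right] at h2
  have h3 := P_one hr1
  rw [Q_eq_eta_add hr1 (by omega) (by omega), QTail, hdiv, Finset.sum_range_one, zero_add,
    neg_invCoeff_two, mul_comm s 2, eta_eq hr1 (by omega), h1, h2,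
    show n + r - 2 * s - 1 = r + (n - 2 * s) - 1 by omega,
    show n + r - s - 1 = r + (n - s) - 1 by omega, delta_eq,
    show r + n - 2 * s = r + (n - 2 * s) by omega, show r + n - s = r + (n - s) by omega,
    mul_pred_div_two]
  generalize (Nat.choose (r + (n - 2 * s)) r : ℤ) = a
  generalize (Nat.choose (r + (n - s)) r : ℤ) = b
  generalize (Nat.choose (r + 2) r : ℤ) = c
  have e1 : q ^ (-(b - a - (c - 1 - r))) = q ^ (a - b) * q ^ (c - ((r + 1 : ℕ) : ℤ)) := by
    rw [← zpow_add₀ q_ne_zero]; congr 1; push_cast; ring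
  have e2 : q ^ (c - ((r + 1 : ℕ) : ℤ)) * q ^ (-(c - 1 - 2 * r)) = q ^ (r : ℤ) := by
    rw [← zpow_add₀ q_ne_zero]; congr 1; push_cast; ring
  rw [e1]
  generalize q ^ (c - ((r + 1 : ℕ) : ℤ)) = u at *
  generalize q ^ (-(c - 1 - 2 * (r : ℤ))) = v at *
  rw [← e2] at h3
  rw [mul_sub, sub_mul, mul_add, mul_one]
  -- The P_2 parts agree; the P_1² part needs one factor P_1 replaced by its closed form.
  linear_combination (-P r 1 * P r (n - s) * q ^ (a - b) *
    ((1 - q ^ (-(Nat.choose (r + (n - 2 * s) - 1) (r - 1) : ℤ))) /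
      (1 - q ^ (-(Nat.choose (r + (n - s) - 1) (r - 1) : ℤ))))) * h3

end

end SymbolicPowerful

theorem theorem2p14 (r s n : ℕ) (hr : 2 ≤ r) (hs : 2 ≤ s) :
    -- (i)
    (2 * s ≤ n → (r : ℤ) ≤ SymbolicPowerful.delta r n s) ∧
    -- (ii)
    ((n < s → SymbolicPowerful.Q r n s = 0) ∧
      (s ≤ n → n < 2 * s → SymbolicPowerful.Q r n s = SymbolicPowerful.eta r n s) ∧
      (2 * s ≤ n → n < 3 * s →
        SymbolicPowerful.Q r n s = SymbolicPowerful.eta r n s *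
          (1 + SymbolicPowerful.q ^ (-SymbolicPowerful.delta r n s) *
            ((1 - SymbolicPowerful.q ^ (-(Nat.choose (n + r - 2 * s - 1) (r - 1) : ℤ))) /
              (1 - SymbolicPowerful.q ^ (-(Nat.choose (n + r - s - 1) (r - 1) : ℤ)))) *
            ((1 - SymbolicPowerful.q ^ (-((r : ℤ) * (r + 1) / 2))) /
                (1 - SymbolicPowerful.q ^ (-(r : ℤ))) -
              SymbolicPowerful.q ^ (-((r : ℤ) * (r - 1) / 2)) *
                ((1 - SymbolicPowerful.q ^ (-(r : ℤ))) /
                  (1 - SymbolicPowerful.q ^ (-1 : ℤ))))))) ∧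
    -- (iii), two variables
    (n = 6 → s = 2 → r = 2 →
      ∃ e : RatFunc ℚ, SymbolicPowerful.IsBigOInv 1 e ∧
        SymbolicPowerful.Q r n s = SymbolicPowerful.eta r n s *
          (1 + SymbolicPowerful.q ^ (-SymbolicPowerful.delta r n s +
              ((r : ℤ) - 2) * (r - 1) * (r + 3) / 6) * (1 + e))) ∧
    -- (iii), at least three variables
    (n = 6 → s = 2 → 3 ≤ r →
      ∃ e : RatFunc ℚ, SymbolicPowerful.IsBigOInv 2 e ∧
        SymbolicPowerful.Q r n s = SymbolicPowerful.eta r n s *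
          (1 + SymbolicPowerful.q ^ (-SymbolicPowerful.delta r n s +
              ((r : ℤ) - 2) * (r - 1) * (r + 3) / 6) *
            (SymbolicPowerful.q ^ (-1 : ℤ) + e))) ∧
    -- (iv)
    (2 * s ≤ n → (n, s) ≠ (6, 2) →
      ∃ e : RatFunc ℚ, SymbolicPowerful.IsBigOInv 1 e ∧
        SymbolicPowerful.Q r n s = SymbolicPowerful.eta r n s *
          (1 + SymbolicPowerful.q ^ (-SymbolicPowerful.delta r n s) * (1 + e))) := by
  open SymbolicPowerful in
  have hr1 : 1 ≤ r := by omega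
  have hs0 : s ≠ 0 := by omega
  refine ⟨le_delta hr hs, ⟨Q_of_lt hs0, fun h1 h2 => ?_, Q_of_lt_three_mul hr hs⟩, ?_, ?_, ?_⟩
  · rw [Q_eq_eta_add hr1 hs0 h1, QTail, Nat.div_eq_of_lt_le (by omega : 1 * s ≤ n) h2,
      Finset.sum_range_zero, add_zero]
  · rintro rfl rfl rfl
    obtain ⟨e, he, h⟩ := exists_add_eq_mul
      (hasMonicDegree_eta hr1 (by norm_num : 2 ≤ 6)) hasMonicDegree_QTail_two_six_two
    refine ⟨e, he, ?_⟩
    rw [Q_eq_eta_add hr1 hs0 (by norm_num), h, delta_eq]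
    norm_num [Nat.choose]
  · rintro rfl rfl hr3
    obtain ⟨e, he, h⟩ := exists_add_eq_mul
      (hasMonicDegree_eta hr1 (by norm_num : 2 ≤ 6)) (hasMonicDegree_QTail_six_two hr3)
    -- Factoring out 𝐪⁻¹ turns the relative error e into 𝐪⁻¹ e, of degree at most -2.
    refine ⟨q ^ (-1 : ℤ) * e, ((degLE_zpow _).mul he).mono (by norm_num), ?_⟩
    rw [Q_eq_eta_add hr1 hs0 (by norm_num), h, delta_eq, cubic_div_six,
      ← mul_one_add (q ^ (-1 : ℤ)), ← mul_assoc, ← zpow_add₀ q_ne_zero]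
    congr 4
    rw [show r + 6 - 2 * 2 = r + 2 by omega]
    ring
  · intro hn h62
    obtain ⟨e, he, h⟩ := exists_add_eq_mul
      (hasMonicDegree_eta hr1 (by omega : s ≤ n)) (hasMonicDegree_QTail hr hs hn h62)
    refine ⟨e, he, ?_⟩
    rw [Q_eq_eta_add hr1 hs0 (by omega), h, delta_eq]
    congr 4
    ring
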